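/- A \emph{$V$-algebra} is a Boolean algebra $C$ with a binary operation $\boxright$ such that for all $x,y,z$: (1) $x\boxright x=1$; (2) $(x\boxright y)\wedge(y\boxright x)\le (x\boxright z)\leftrightarrow(y\boxright z)$; (3) $((x\vee y)\boxright x)\vee((x\vee y)\boxright y)\vee\big(((x\vee y)\boxright z)\leftrightarrow((x\boxright z)\wedge(y\boxright z))\big)=1$; (4) $x\boxright(y\wedge z)=(x\boxright y)\wedge(x\boxright z)$. Morphisms are the homomorphisms for all the operations. An \emph{LC-algebra} is a $V$-algebra with $x\wedge y\le x\boxright y\le x\to y$ for all $x,y$; a \emph{CA-algebra} is an LC-algebra with $(x\boxright y)\vee(x\boxright\neg y)=1$ for all $x,y$. For a Stone space $S$ let $Cl(S)$ be its Boolean algebra of clopen sets. For $\sigma:S\to\mathcal P(\mathcal P(S))$, $A\in Cl(S)$, $x\in S$, let $\Sigma(A,x)=\bigcap\{U\in\sigma(x): U\cap A\neq\emptyset\}$, with the convention $\Sigma(A,x)=\emptyset$ if no $U\in\sigma(x)$ meets $A$. A \emph{topological sphere} is a Stone space $S$ with a map $\sigma:S\to\mathcal P(\mathcal P(S))$ such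 that for all $x\in S$ and $A,B\in Cl(S)$: $\sigma(x)$ is a chain under inclusion; $\{z\in S: A\cap\Sigma(A,z)\subseteq B\}$ is clopen; if $A\cap\bigcup\sigma(x)\ne\emptyset$, there is a smallest $U\in\sigma(x)$ with $U\cap A\neq\emptyset$; and $A\cap\Sigma(A,x)$ is closed. A \emph{sphere morphism} $(S,\sigma)\to(S',\sigma')$ is a continuous map $\varphi:S\to S'$ such that for all $x\in S$ and $A'\in Cl(S')$: (i) if $\varphi^{-1}[A']\cap\bigcup\sigma(x)\neq\emptyset$, then $y\in\varphi^{-1}[A']\cap\Sigma(\varphi^{-1}[A'],x)$ implies $\varphi(y)\in\Sigma'(A',\varphi(x))$; (ii) if $A'\cap\bigcup\sigma'(\varphi(x))\neq\emptyset$, then for every $y'\in A'\cap\Sigma'(A',\varphi(x))$ there is $y\in\Sigma(\varphi^{-1}[A'],x)$ with $\varphi(y)=y'$. A topological sphere is \emph{centered} if $\{x\}\in\sigma(x)$ for all $x$; it is \emph{Stalnakerian} if it is centered and, for all $x\in S$ and $A\in Cl(S)$ with $A\cap\bigcup\sigma(x)\neq\emptyset$, there are $U\in\sigma(x)$ and $y\in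 S$ with $A\cap U=\{y\}$. A \emph{topological $\alpha$-model} is a Stone space $S$ with a map $f:Cl(S)\times S\to\mathcal P(S)$ such that for all $A,B\in Cl(S)$, $x\in S$: $f(A,x)\subseteq A$; if $f(A,x)\subseteq B$ and $f(B,x)\subseteq A$ then $f(A,x)=f(B,x)$; $f(A\cup B,x)\subseteq A$ or $f(A\cup B,x)\subseteq B$ or $f(A\cup B,x)=f(A,x)\cup f(B,x)$; $\{z\in S:f(A,z)\subseteq B\}$ is clopen; $f(A,x)$ is closed. An \emph{$\alpha$-morphism} $(S,f)\to(S',f')$ is a continuous map $\varphi:S\to S'$ such that for all $A'\in Cl(S')$, $x\in S$: $y\in f(\varphi^{-1}[A'],x)$ implies $\varphi(y)\in f'(A',\varphi(x))$, and for every $y'\in f'(A',\varphi(x))$ there is $y\in f(\varphi^{-1}[A'],x)$ with $\varphi(y)=y'$. Let $\mathrm A$ be the functor from topological spheres to topological $\alpha$-models with $\mathrm A(S,\sigma)=(S,f_\sigma)$, $f_\sigma(A,x)=A\cap\Sigma(A,x)$, and $\mathrm A(\varphi)=\varphi$. Let $\mathscr C$ be the contravariant functor from topological $\alpha$-models to $V$-algebras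 sending $(S,f)$ to $Cl(S)$ with $A\boxright B=\{x\in S:f(A,x)\subseteq B\}$, and $\varphi$ to $A\mapsto\varphi^{-1}[A]$. \textbf{Theorem.} The composite contravariant functor $\mathscr C\circ\mathrm A$ is a dual equivalence between the category of topological spheres with sphere morphisms and the category of $V$-algebras with homomorphisms. Moreover, it sends centered topological spheres to LC-algebras and Stalnakerian topological spheres to CA-algebras, and its restrictions to these full subcategories are dual equivalences between centered topological spheres and LC-algebras, and between Stalnakerian topological spheres and CA-algebras. -/

import Mathlib

open CategoryTheory TopologicalSpace Opposite

universe u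

/-! ### Algebras -/

/-- Lewis variably strict conditional algebras (`V`-algebras): Boolean algebras with a
counterfactual conditional `cf`. -/
class VAlgebra (C : Type u) extends BooleanAlgebra C where
  /-- The counterfactual conditional. -/
  cf : C → C → C
  cf_self : ∀ x, cf x x = ⊤
  cf_le : ∀ x y z, cf x y ⊓ cf y x ≤ bihimp (cf x z) (cf y z)
  cf_sup : ∀ x y z,
    cf (x ⊔ y) x ⊔ cf (x ⊔ y) y ⊔ bihimp (cf (x ⊔ y) z) (cf x z ⊓ cf y z) = ⊤
  cf_inf : ∀ x y z, cf x (y ⊓ z) = cf x y ⊓ cf x z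

/-- Homomorphisms of `V`-algebras. -/
@[ext]
structure VAlgebraHom (C D : Type u) [VAlgebra C] [VAlgebra D] extends
    BoundedLatticeHom C D where
  map_cf' : ∀ x y, toFun (VAlgebra.cf x y) = VAlgebra.cf (toFun x) (toFun y)

/-- Bundled `V`-algebras. -/
structure VAlg : Type (u + 1) where
  carrier : Type u
  [str : VAlgebra carrier]

attribute [instance] VAlg.str

/-- The algebraic category of `V`-algebras. -/
instance VAlg.category : Category VAlg.{u} where
  Hom C D := VAlgebraHom C.carrier D.carrier
  id C := { BoundedLatticeHom.id C.carrier with map_cf' := fun _ _ => rfl }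
  comp g h :=
    { h.toBoundedLatticeHom.comp g.toBoundedLatticeHom with
      map_cf' := fun x y => (congrArg h.toFun (g.map_cf' x y)).trans (h.map_cf' _ _) }

/-- `LC`-algebras: the `V`-algebras with `x ⊓ y ≤ cf x y ≤ x ⇨ y`. -/
def VAlg.IsLC : ObjectProperty VAlg.{u} := fun C =>
  ∀ x y : C.carrier, x ⊓ y ≤ VAlgebra.cf x y ∧ VAlgebra.cf x y ≤ x ⇨ y

/-- Lewis conditional algebras (`CA`-algebras). -/
def VAlg.IsCA : ObjectProperty VAlg.{u} := fun C =>
  VAlg.IsLC C ∧ ∀ x y : C.carrier, VAlgebra.cf x y ⊔ VAlgebra.cf x yᶜ = ⊤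

/-! ### Topological alpha-models -/

/-- The preimage of a clopen set under a continuous map. -/
def clopenPreimage {S T : Type u} [TopologicalSpace S] [TopologicalSpace T]
    (φ : S → T) (hφ : Continuous φ) (A : Clopens T) : Clopens S :=
  ⟨φ ⁻¹' (A : Set T), A.isClopen.preimage hφ⟩

/-- Topological alpha-models: Stone spaces with a selection function `f`. -/
structure AlphaModel : Type (u + 1) where
  carrier : Type u
  [top : TopologicalSpace carrier]
  [compact : CompactSpace carrier]
  [hausdorff : T2Space carrier]
  [disconnected : TotallyDisconnectedSpace carrier]
  f : Clopens carrier → carrier → Set carrier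
  subset_self : ∀ A x, f A x ⊆ A
  eq_of_subset : ∀ (A B : Clopens carrier) (x : carrier), f A x ⊆ B → f B x ⊆ A → f A x = f B x
  sup_cases : ∀ A B x, f (A ⊔ B) x ⊆ A ∨ f (A ⊔ B) x ⊆ B ∨ f (A ⊔ B) x = f A x ∪ f B x
  isClopen_cf : ∀ A B : Clopens carrier, IsClopen {x | f A x ⊆ B}
  isClosed_f : ∀ A x, IsClosed (f A x)

attribute [instance] AlphaModel.top AlphaModel.compact AlphaModel.hausdorff
  AlphaModel.disconnected

/-- Alpha-morphisms. -/
@[ext]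
structure AlphaHom (M N : AlphaModel.{u}) where
  toFun : M.carrier → N.carrier
  continuous : Continuous toFun
  forth : ∀ (A : Clopens N.carrier) (x y : M.carrier),
    y ∈ M.f (clopenPreimage toFun continuous A) x → toFun y ∈ N.f A (toFun x)
  back : ∀ (A : Clopens N.carrier) (x : M.carrier) (y' : N.carrier),
    y' ∈ N.f A (toFun x) →
      ∃ y, toFun y = y' ∧ y ∈ M.f (clopenPreimage toFun continuous A) x

/-- The category of topological alpha-models and alpha-morphisms. -/
instance AlphaModel.category : Category AlphaModel.{u} where
  Hom := AlphaHom
  id M :=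
    { toFun := id
      continuous := continuous_id
      forth := fun _ _ _ h => h
      back := fun _ _ y' h => ⟨y', rfl, h⟩ }
  comp g h :=
    { toFun := h.toFun ∘ g.toFun
      continuous := h.continuous.comp g.continuous
      forth := fun A x y hy =>
        h.forth A _ _ (g.forth (clopenPreimage h.toFun h.continuous A) x y hy)
      back := fun A x y' hy' => by
        obtain ⟨z, rfl, hz⟩ := h.back A _ y' hy'
        obtain ⟨y, rfl, hy⟩ := g.back _ x z hz
        exact ⟨y, rfl, hy⟩ }

theorem mem_bihimp_clopens {S : Type u} [TopologicalSpace S] (A B : Clopens S) (x : S) :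
    x ∈ bihimp A B ↔ (x ∈ A ↔ x ∈ B) := by
  change x ∈ (B ⇨ A : Set S) ∩ (A ⇨ B : Set S) ↔ _
  simp only [himp_eq, Set.sup_eq_union, Set.mem_inter_iff, Set.mem_union, Set.mem_compl_iff,
    SetLike.mem_coe]
  tauto

/-- The `V`-algebra of clopen subsets of a topological alpha-model, with conditional
`{x | f A x ⊆ B}`. -/
@[reducible]
def AlphaModel.vAlgebra (M : AlphaModel.{u}) : VAlgebra (Clopens M.carrier) where
  cf A B := ⟨{x | M.f A x ⊆ B}, M.isClopen_cf A B⟩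
  cf_self A := by
    ext x
    exact iff_of_true (M.subset_self A x) trivial
  cf_le A B C := by
    rintro x ⟨h₁, h₂⟩
    have h := M.eq_of_subset A B x h₁ h₂
    rw [mem_bihimp_clopens]
    change M.f A x ⊆ C ↔ M.f B x ⊆ C
    rw [h]
  cf_sup A B C := by
    ext x
    refine iff_of_true ?_ trivial
    change (M.f (A ⊔ B) x ⊆ A ∨ M.f (A ⊔ B) x ⊆ B) ∨ x ∈ (bihimp _ _ : Clopens M.carrier)
    rw [mem_bihimp_clopens]
    change _ ∨ (M.f (A ⊔ B) x ⊆ C ↔ M.f A x ⊆ C ∧ M.f B x ⊆ C)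
    rcases M.sup_cases A B x with h | h | h
    · exact Or.inl (Or.inl h)
    · exact Or.inl (Or.inr h)
    · right
      rw [h, Set.union_subset_iff]
  cf_inf A B C := by
    ext x
    exact Set.subset_inter_iff

/-- The contravariant functor sending a topological alpha-model to the `V`-algebra of its clopen
sets, and an alpha-morphism to the preimage map. -/
def alphaToVAlg : AlphaModel.{u}ᵒᵖ ⥤ VAlg.{u} where
  obj M := @VAlg.mk (Clopens M.unop.carrier) M.unop.vAlgebra
  map {M N} φ :=
    letI := M.unop.vAlgebra
    letI := N.unop.vAlgebra
    ({ toFun := clopenPreimage φ.unop.toFun φ.unop.continuous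
       map_sup' := fun _ _ => rfl
       map_inf' := fun _ _ => rfl
       map_top' := rfl
       map_bot' := rfl
       map_cf' := fun A B => by
         ext x
         constructor
         · intro h y hy
           exact h (φ.unop.forth A x y hy)
         · intro h y' hy'
           obtain ⟨y, rfl, hy⟩ := φ.unop.back A x y' hy'
           exact h hy } :
      VAlgebraHom (Clopens M.unop.carrier) (Clopens N.unop.carrier))

/-! ### Topological spheres -/

/-- `sphereInter σ A x` is the intersection of all the members of `σ x` that meet `A`; by convention
it is empty when no member of `σ x` meets `A`. -/
def sphereInter {S : Type u} (σ : S → Set (Set S)) (A : Set S) (x : S) : Set S :=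
  {y | (∃ U ∈ σ x, (U ∩ A).Nonempty) ∧ ∀ U ∈ σ x, (U ∩ A).Nonempty → y ∈ U}

/-- Topological spheres. -/
structure TopSphere : Type (u + 1) where
  carrier : Type u
  [top : TopologicalSpace carrier]
  [compact : CompactSpace carrier]
  [hausdorff : T2Space carrier]
  [disconnected : TotallyDisconnectedSpace carrier]
  σ : carrier → Set (Set carrier)
  nested : ∀ x, ∀ U ∈ σ x, ∀ V ∈ σ x, U ⊆ V ∨ V ⊆ U
  isClopen_cf : ∀ A B : Clopens carrier,
    IsClopen {x | (A : Set carrier) ∩ sphereInter σ A x ⊆ B}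
  limit : ∀ (x : carrier) (A : Clopens carrier), ((A : Set carrier) ∩ ⋃₀ σ x).Nonempty →
    ∃ U, IsLeast {V | V ∈ σ x ∧ (V ∩ (A : Set carrier)).Nonempty} U
  isClosed_inter : ∀ (x : carrier) (A : Clopens carrier),
    IsClosed ((A : Set carrier) ∩ sphereInter σ A x)

attribute [instance] TopSphere.top TopSphere.compact TopSphere.hausdorff TopSphere.disconnected

/-- Sphere morphisms. -/
@[ext]
structure SphereHom (X Y : TopSphere.{u}) where
  toFun : X.carrier → Y.carrier
  continuous : Continuous toFun
  forth : ∀ (A : Clopens Y.carrier) (x y : X.carrier),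
    (toFun ⁻¹' (A : Set Y.carrier) ∩ ⋃₀ X.σ x).Nonempty →
      y ∈ toFun ⁻¹' (A : Set Y.carrier) ∩ sphereInter X.σ (toFun ⁻¹' (A : Set Y.carrier)) x →
        toFun y ∈ sphereInter Y.σ A (toFun x)
  back : ∀ (A : Clopens Y.carrier) (x : X.carrier) (y' : Y.carrier),
    ((A : Set Y.carrier) ∩ ⋃₀ Y.σ (toFun x)).Nonempty →
      y' ∈ (A : Set Y.carrier) ∩ sphereInter Y.σ A (toFun x) →
        ∃ y, toFun y = y' ∧ y ∈ sphereInter X.σ (toFun ⁻¹' (A : Set Y.carrier)) x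

theorem meets_of_mem_sphereInter {S : Type u} {σ : S → Set (Set S)} {A : Set S} {x y : S}
    (h : y ∈ sphereInter σ A x) : (A ∩ ⋃₀ σ x).Nonempty := by
  obtain ⟨U, hU, z, hzU, hzA⟩ := h.1
  exact ⟨z, hzA, U, hU, hzU⟩

/-- The category of topological spheres and sphere morphisms. -/
instance TopSphere.category : Category TopSphere.{u} where
  Hom := SphereHom
  id X :=
    { toFun := id
      continuous := continuous_id
      forth := fun _ _ _ _ h => h.2
      back := fun _ _ y' _ h => ⟨y', rfl, h.2⟩ }
  comp g h :=
    { toFun := h.toFun ∘ g.toFun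
      continuous := h.continuous.comp g.continuous
      forth := fun A x y hne hy => by
        have hg := g.forth (clopenPreimage h.toFun h.continuous A) x y hne hy
        exact h.forth A _ _ (meets_of_mem_sphereInter hg) ⟨hy.1, hg⟩
      back := fun A x y' hne hy' => by
        obtain ⟨z, rfl, hz⟩ := h.back A _ y' hne hy'
        obtain ⟨y, rfl, hy⟩ := g.back (clopenPreimage h.toFun h.continuous A) x z
          (meets_of_mem_sphereInter hz) ⟨hy'.1, hz⟩
        exact ⟨y, rfl, hy⟩ }

/-- Centered topological spheres. -/
def TopSphere.IsCentered : ObjectProperty TopSphere.{u} := fun X =>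
  ∀ x : X.carrier, {x} ∈ X.σ x

/-- Stalnakerian topological spheres. -/
def TopSphere.IsStalnakerian : ObjectProperty TopSphere.{u} := fun X =>
  TopSphere.IsCentered X ∧
    ∀ (A : Clopens X.carrier) (x : X.carrier), ((A : Set X.carrier) ∩ ⋃₀ X.σ x).Nonempty →
      ∃ U ∈ X.σ x, ∃ y, (A : Set X.carrier) ∩ U = {y}

/-- The topological alpha-model of a topological sphere. -/
def TopSphere.toAlphaModel (X : TopSphere.{u}) : AlphaModel.{u} where
  carrier := X.carrier
  f A x := (A : Set X.carrier) ∩ sphereInter X.σ A x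
  subset_self _ _ := Set.inter_subset_left
  eq_of_subset A B x hAB hBA := by
    -- A nonempty value of `f A x` is witnessed by the least member of `σ x` that meets `A`.
    have key : ∀ A B : Clopens X.carrier,
        (A : Set X.carrier) ∩ sphereInter X.σ A x ⊆ B →
        (B : Set X.carrier) ∩ sphereInter X.σ B x ⊆ A →
        (A : Set X.carrier) ∩ sphereInter X.σ A x ⊆
          (B : Set X.carrier) ∩ sphereInter X.σ B x := by
      intro A B hAB hBA y hy
      obtain ⟨U, ⟨hU, z, hzU, hzA⟩, hmin⟩ := X.limit x A (meets_of_mem_sphereInter hy.2)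
      have hz : z ∈ (A : Set X.carrier) ∩ sphereInter X.σ A x :=
        ⟨hzA, ⟨U, hU, z, hzU, hzA⟩, fun V hV hVA => hmin ⟨hV, hVA⟩ hzU⟩
      have hzB := hAB hz
      refine ⟨hAB hy, ⟨U, hU, z, hzU, hzB⟩, fun V hV hVB => ?_⟩
      obtain ⟨W, ⟨hW, w, hwW, hwB⟩, hWmin⟩ :=
        X.limit x B ⟨z, hzB, U, hU, hzU⟩
      have hw : w ∈ (B : Set X.carrier) ∩ sphereInter X.σ B x :=
        ⟨hwB, ⟨W, hW, w, hwW, hwB⟩, fun V hV hVB => hWmin ⟨hV, hVB⟩ hwW⟩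
      exact hWmin ⟨hV, hVB⟩ (hy.2.2 W hW ⟨w, hwW, hBA hw⟩)
    exact (key A B hAB hBA).antisymm (key B A hBA hAB)
  sup_cases A B x := by
    by_cases h : ∃ U ∈ X.σ x, (U ∩ ((A ⊔ B : Clopens X.carrier) : Set X.carrier)).Nonempty
    · obtain ⟨V, hV, v, hvV, hv⟩ := h
      obtain ⟨U, ⟨hU, hne⟩, hmin⟩ := X.limit x (A ⊔ B) ⟨v, hv, V, hV, hvV⟩
      have hsub : sphereInter X.σ ((A ⊔ B : Clopens X.carrier) : Set X.carrier) x = U := by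
        ext y
        exact ⟨fun hy => hy.2 U hU hne, fun hy => ⟨⟨U, hU, hne⟩, fun W hW hWm =>
          hmin ⟨hW, hWm⟩ hy⟩⟩
      have hone : ∀ C : Clopens X.carrier, C ≤ A ⊔ B → (U ∩ (C : Set X.carrier)).Nonempty →
          sphereInter X.σ (C : Set X.carrier) x = U := by
        intro C hC hUC
        ext y
        refine ⟨fun hy => hy.2 U hU hUC, fun hy => ⟨⟨U, hU, hUC⟩, fun W hW hWm =>
          hmin ⟨hW, hWm.mono ?_⟩ hy⟩⟩
        exact Set.inter_subset_inter_right W hC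
      simp only [hsub]
      by_cases hA : (U ∩ (A : Set X.carrier)).Nonempty
      · by_cases hB : (U ∩ (B : Set X.carrier)).Nonempty
        · right; right
          rw [hone A le_sup_left hA, hone B le_sup_right hB, Clopens.coe_sup,
            Set.union_inter_distrib_right]
        · left
          rintro y ⟨hy | hy, hyU⟩
          · exact hy
          · exact (hB ⟨y, hyU, hy⟩).elim
      · right; left
        rintro y ⟨hy | hy, hyU⟩
        · exact (hA ⟨y, hyU, hy⟩).elim
        · exact hy
    · left
      rintro y ⟨-, hy, -⟩
      exact (h hy).elim
  isClopen_cf := X.isClopen_cf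
  isClosed_f A x := X.isClosed_inter x A

/-- The functor from topological spheres to topological alpha-models; it is the identity on
underlying maps. -/
def sphereToAlpha : TopSphere.{u} ⥤ AlphaModel.{u} where
  obj X := X.toAlphaModel
  map {X Y} φ :=
    ({ toFun := φ.toFun
       continuous := φ.continuous
       forth := fun A x y hy =>
         ⟨hy.1, φ.forth A x y (meets_of_mem_sphereInter hy.2) hy⟩
       back := fun A x y' hy' => by
         obtain ⟨y, rfl, hy⟩ := φ.back A x y' (meets_of_mem_sphereInter hy'.2) hy'
         exact ⟨y, rfl, hy'.1, hy⟩ } : AlphaHom X.toAlphaModel Y.toAlphaModel)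

/-- The composite contravariant functor from topological spheres to `V`-algebras. -/
def sphereToVAlg : TopSphere.{u}ᵒᵖ ⥤ VAlg.{u} :=
  sphereToAlpha.op ⋙ alphaToVAlg

/-! ### Stone spaces and their clopen algebras -/

/-! A closed subset of a Stone space is determined by its clopen supersets. A selection function
with closed values therefore carries the same data as the conditional `{x | f A x ⊆ B}`, and `f A x`
is recovered as the intersection of all `B` with `x ∈ cf A B`. Compactness shows that this
intersection lies in no further clopen `B` (`selection_subset_iff`), and laws (2) and (3) translate
into the axioms on `f`.

Full faithfulness: Boolean homomorphisms of clopen algebras are preimages along continuous maps.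
Preservation of `cf` says that `φ '' f (φ⁻¹ A) x` and `f' A (φ x)` have the same clopen supersets.
Both are closed, so they agree, which is exactly the forth and back conditions (`image_f_eq`).

Essential surjectivity: Stone duality reduces it to finding a sphere system for an alpha-model. The
smallest sphere around `x` meeting `A` is taken to be the union of all `f B x` with `A ≤ B`, when `f
A x` is nonempty. These sets form a chain, and each cuts `A` exactly in `f A x` (`sphere_inter`,
`sphere_total`, `isLeast_sphere`). The LC law forces `f ⊤ x = {x}`, making `{x}` a sphere; the CA
law forces `f A x` to have at most one point. -/

section Stone

variable {S T : Type u} [TopologicalSpace S] [CompactSpace S] [TopologicalSpace T]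

/-- The filter form of compactness: a nonempty family of clopen sets that is closed under binary
intersections and has its intersection in a clopen set has a member inside that clopen set. -/
theorem exists_subset_of_iInter_clopens_subset (F : Set (Clopens S)) (hne : F.Nonempty)
    (hF : ∀ A ∈ F, ∀ B ∈ F, A ⊓ B ∈ F) (C : Clopens S)
    (h : ∀ y, (∀ A ∈ F, y ∈ A) → y ∈ C) : ∃ A ∈ F, A ≤ C := by
  have : Nonempty F := hne.to_subtype
  have hdir : Directed (· ⊇ ·) fun A : F => (A : Set S) := fun A B =>
    ⟨⟨A ⊓ B, hF A A.2 B B.2⟩, fun _ hy => hy.1, fun _ hy => hy.2⟩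
  obtain ⟨A, hA⟩ := exists_subset_nhds_of_isCompact' hdir
    (fun A => A.1.isClopen.isClosed.isCompact) (fun A => A.1.isClopen.isClosed)
    (U := (C : Set S)) (fun y hy => C.isClopen.isOpen.mem_nhds
      (h y fun A hA => Set.mem_iInter.1 hy ⟨A, hA⟩))
  exact ⟨A, A.2, hA⟩

variable [T2Space S] [TotallyDisconnectedSpace S]

/-- A closed subset of a Stone space is the intersection of its clopen supersets. -/
theorem subset_of_forall_clopens_subset {K L : Set S} (hK : IsClosed K)
    (h : ∀ C : Clopens S, K ⊆ C → L ⊆ C) : L ⊆ K := by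
  intro y hy
  by_contra hyK
  obtain ⟨V, hV, hyV, hVK⟩ := compact_exists_isClopen_in_isOpen hK.isOpen_compl hyK
  exact h ⟨Vᶜ, hV.compl⟩ (fun z hz hzV => hVK hzV hz) hy hyV

theorem eq_of_forall_clopens_subset_iff {K L : Set S} (hK : IsClosed K) (hL : IsClosed L)
    (h : ∀ C : Clopens S, K ⊆ C ↔ L ⊆ C) : K = L :=
  (subset_of_forall_clopens_subset hL fun C => (h C).2).antisymm
    (subset_of_forall_clopens_subset hK fun C => (h C).1)

theorem eq_of_forall_mem_clopens {x y : S} (h : ∀ C : Clopens S, x ∈ C → y ∈ C) : y = x := by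
  have := subset_of_forall_clopens_subset (K := {x}) (L := {y}) isClosed_singleton
    fun C hC => Set.singleton_subset_iff.2 (h C (Set.singleton_subset_iff.1 hC))
  exact Set.singleton_subset_singleton.1 this

/-- A Boolean homomorphism between clopen algebras of Stone spaces is the preimage map of a
continuous map. -/
theorem exists_continuous_clopenPreimage_eq (g : BoundedLatticeHom (Clopens S) (Clopens T)) :
    ∃ (φ : T → S) (hφ : Continuous φ), ∀ A, clopenPreimage φ hφ A = g A := by
  have hpt : ∀ x : T, ∃ y : S, ∀ A : Clopens S, y ∈ A ↔ x ∈ g A := by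
    intro x
    have hex : ∃ y : S, ∀ A : Clopens S, x ∈ g A → y ∈ A := by
      -- The clopens whose image contains `x` form a filter. If it had no common point, compactness
      -- would put `⊥` in it.
      by_contra! hcon
      obtain ⟨A, hA, hle⟩ := exists_subset_of_iInter_clopens_subset {A | x ∈ g A}
        ⟨⊤, by
          change x ∈ g ⊤
          rw [map_top]
          trivial⟩
        (fun A hA B hB => by
          change x ∈ g (A ⊓ B)
          rw [map_inf]
          exact ⟨hA, hB⟩) ⊥
        (fun y hy => by
          obtain ⟨A, hA, hyA⟩ := hcon y
          exact (hyA (hy A hA)).elim)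
      have hbot : x ∈ g ⊥ := le_bot_iff.1 hle ▸ hA
      rw [map_bot] at hbot
      exact hbot
    obtain ⟨y, hy⟩ := hex
    refine ⟨y, fun A => ⟨fun hyA => ?_, hy A⟩⟩
    by_contra hx
    have hc : x ∈ g Aᶜ := by
      rw [map_compl']
      exact hx
    exact hy _ hc hyA
  choose φ hφ using hpt
  have hcont : Continuous φ := isTopologicalBasis_isClopen.continuous_iff.2 fun U hU => by
    have : φ ⁻¹' U = (g ⟨U, hU⟩ : Set T) := Set.ext fun x => hφ x ⟨U, hU⟩
    rw [this]
    exact (g ⟨U, hU⟩).isClopen.isOpen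
  exact ⟨φ, hcont, fun A => Clopens.ext (Set.ext fun x => hφ x A)⟩

end Stone

/-! ### Stone representation by two-valued homomorphisms. -/

section StonePoint

variable (C : Type u) [BooleanAlgebra C]

/-- The points of the Stone space of a Boolean algebra: its two-valued homomorphisms. -/
abbrev StonePoint : Type u :=
  {p : C → Bool // p ⊤ = true ∧ (∀ a b, p (a ⊓ b) = (p a && p b)) ∧ ∀ a, p aᶜ = !p a}

/-- Each law involves finitely many coordinates, so the points form a closed subset of the compact
product of copies of `Bool`. -/
instance StonePoint.compactSpace : CompactSpace (StonePoint C) := by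
  have hinf : IsClosed {p : C → Bool | ∀ a b, p (a ⊓ b) = (p a && p b)} := by
    simp only [Set.ofPred_forall]
    refine isClosed_iInter fun a => isClosed_iInter fun b => isClosed_eq (continuous_apply _) ?_
    have hand : Continuous fun q : Bool × Bool => q.1 && q.2 := continuous_of_discreteTopology
    exact hand.comp (Continuous.prodMk (continuous_apply (A := fun _ : C => Bool) a)
      (continuous_apply (A := fun _ : C => Bool) b))
  have hcompl : IsClosed {p : C → Bool | ∀ a, p aᶜ = !p a} := by
    simp only [Set.ofPred_forall]
    refine isClosed_iInter fun a => isClosed_eq (continuous_apply _) ?_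
    exact (continuous_of_discreteTopology (f := fun q : Bool => !q)).comp (continuous_apply a)
  have htop : IsClosed {p : C → Bool | p ⊤ = true} :=
    isClosed_eq (continuous_apply _) continuous_const
  exact isCompact_iff_compactSpace.1 (htop.inter (hinf.inter hcompl)).isCompact

variable {C}

/-- The clopen set of points at which an element of the Boolean algebra is true. -/
def StonePoint.basic (a : C) : Clopens (StonePoint C) :=
  ⟨{p | p.1 a = true},
    (isClopen_discrete {true}).preimage ((continuous_apply a).comp continuous_subtype_val)⟩

theorem StonePoint.mem_basic {a : C} {p : StonePoint C} : p ∈ basic a ↔ p.1 a = true := Iff.rfl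

theorem StonePoint.basic_top : basic (⊤ : C) = ⊤ := by
  ext p
  exact iff_of_true p.2.1 trivial

theorem StonePoint.basic_inf (a b : C) : basic (a ⊓ b) = basic a ⊓ basic b := by
  ext p
  change p.1 (a ⊓ b) = true ↔ p.1 a = true ∧ p.1 b = true
  rw [p.2.2.1, Bool.and_eq_true]

theorem StonePoint.basic_compl (a : C) : basic aᶜ = (basic a)ᶜ := by
  ext p
  change p.1 aᶜ = true ↔ ¬ p.1 a = true
  rw [p.2.2.2]
  simp

/-- The Boolean prime ideal theorem, for points of the Stone space. -/
theorem StonePoint.exists_mem_basic {a : C} (ha : a ≠ ⊥) : ∃ p : StonePoint C, p ∈ basic a := by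
  classical
  obtain ⟨J, hJ, -, hd⟩ := DistribLattice.prime_ideal_of_disjoint_filter_ideal
    (F := Order.PFilter.principal a) (I := Order.Ideal.principal (⊥ : C)) (by
      rw [Set.disjoint_left]
      intro b hb hb'
      exact ha (le_bot_iff.1 ((Order.PFilter.mem_principal.1 hb).trans
        (Order.Ideal.mem_principal.1 hb'))))
  have hinf : ∀ b c, b ⊓ c ∈ J ↔ b ∈ J ∨ c ∈ J := fun b c =>
    ⟨hJ.mem_or_mem, fun h => h.elim (J.lower inf_le_left) (J.lower inf_le_right)⟩
  have htop : (⊤ : C) ∉ J := Order.Ideal.IsProper.top_notMem hJ.toIsProper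
  have hcompl : ∀ b, bᶜ ∈ J ↔ b ∉ J := by
    intro b
    constructor
    · intro hb hb'
      have := Order.Ideal.sup_mem hb' hb
      rw [sup_compl_eq_top] at this
      exact htop this
    · intro hb
      have hbot : b ⊓ bᶜ ∈ J := by
        rw [inf_compl_eq_bot]
        exact J.bot_mem
      exact ((hinf _ _).1 hbot).resolve_left hb
  -- The point is the indicator of the ultrafilter complementary to the prime ideal `J`.
  refine ⟨⟨fun b => decide (b ∉ J), ?_, fun b c => ?_, fun b => ?_⟩, ?_⟩
  · simpa using htop
  · simp [hinf]
  · simp [hcompl]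
  · rw [mem_basic]
    simpa using fun h => Set.disjoint_left.1 hd (Order.PFilter.mem_principal.2 le_rfl) h

theorem StonePoint.basic_le_basic {a b : C} : basic a ≤ basic b ↔ a ≤ b := by
  constructor
  · intro h
    by_contra hab
    obtain ⟨p, hp⟩ := exists_mem_basic (a := a ⊓ bᶜ) fun h0 =>
      hab (by rwa [← disjoint_iff, disjoint_compl_right_iff] at h0)
    rw [basic_inf, basic_compl] at hp
    exact hp.2 (h hp.1)
  · intro h
    rw [← inf_eq_left.2 h, basic_inf]
    exact inf_le_right

theorem StonePoint.eq_of_forall_mem_basic {p q : StonePoint C}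
    (h : ∀ a : C, p ∈ basic a → q ∈ basic a) : p = q := by
  refine Subtype.ext (funext fun a => ?_)
  rw [Bool.eq_iff_iff]
  refine ⟨h a, fun hq => ?_⟩
  by_contra hp
  have : p ∈ basic aᶜ := by
    rw [basic_compl]
    exact hp
  have := h _ this
  rw [basic_compl] at this
  exact this hq

/-- Compactness is used twice: to shrink to a basic set around a point, and to cover `A` by a single
basic set, basic sets being closed under finite joins. -/
theorem StonePoint.basic_surjective :
    Function.Surjective (basic : C → Clopens (StonePoint C)) := by
  intro A
  -- Each point of `A` has a basic neighbourhood inside `A`.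
  have hpt : ∀ p ∈ A, ∃ a : C, p ∈ basic a ∧ basic a ≤ A := by
    intro p hp
    obtain ⟨_, ⟨a, ha, rfl⟩, hle⟩ := exists_subset_of_iInter_clopens_subset
      (basic '' {a : C | p ∈ basic a}) ⟨_, ⊤, p.2.1, rfl⟩
      (by
        rintro _ ⟨a, ha, rfl⟩ _ ⟨b, hb, rfl⟩
        refine ⟨a ⊓ b, ?_, basic_inf a b⟩
        change p ∈ basic (a ⊓ b)
        rw [basic_inf]
        exact ⟨ha, hb⟩) A
      (fun q hq => by
        rwa [← eq_of_forall_mem_basic fun a ha => hq _ ⟨a, ha, rfl⟩])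
    exact ⟨a, ha, hle⟩
  -- The basic sets inside `A`, complemented, have empty intersection on `A`.
  obtain ⟨_, ⟨a, ha, rfl⟩, hle⟩ := exists_subset_of_iInter_clopens_subset
    ((fun a : C => (basic a)ᶜ) '' {a : C | basic a ≤ A})
    ⟨_, ⊥, by
      rw [Set.mem_ofPred_eq, ← compl_top, basic_compl, basic_top, compl_top]
      exact bot_le, rfl⟩
    (by
      rintro _ ⟨a, ha, rfl⟩ _ ⟨b, hb, rfl⟩
      have hab : basic (a ⊔ b) = basic a ⊔ basic b := by
        rw [← compl_compl (a ⊔ b), basic_compl, compl_sup, basic_inf, basic_compl, basic_compl,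
          ← compl_sup, compl_compl]
      refine ⟨a ⊔ b, ?_, ?_⟩
      · rw [Set.mem_ofPred_eq, hab]
        exact sup_le ha hb
      · simp only [hab, compl_sup]) Aᶜ
    (fun q hq => by
      intro hqA
      obtain ⟨a, hqa, haA⟩ := hpt q hqA
      exact hq _ ⟨a, haA, rfl⟩ hqa)
  exact ⟨a, ha.antisymm (compl_le_compl_iff_le.1 hle)⟩

/-- Stone's representation theorem. -/
noncomputable def StonePoint.orderIso : C ≃o Clopens (StonePoint C) where
  toEquiv := Equiv.ofBijective basic
    ⟨fun _ _ h => le_antisymm (basic_le_basic.1 h.le) (basic_le_basic.1 h.ge), basic_surjective⟩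
  map_rel_iff' := basic_le_basic

end StonePoint

/-! ### Conditionals on clopen algebras and selection functions -/

/-- The laws of the conditional of a `V`-algebra, for an operation on a Boolean algebra. -/
structure IsVConditional {C : Type u} [BooleanAlgebra C] (cf : C → C → C) : Prop where
  cf_self : ∀ x, cf x x = ⊤
  cf_le : ∀ x y z, cf x y ⊓ cf y x ≤ bihimp (cf x z) (cf y z)
  cf_sup : ∀ x y z,
    cf (x ⊔ y) x ⊔ cf (x ⊔ y) y ⊔ bihimp (cf (x ⊔ y) z) (cf x z ⊓ cf y z) = ⊤
  cf_inf : ∀ x y z, cf x (y ⊓ z) = cf x y ⊓ cf x z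

theorem VAlgebra.isVConditional (C : Type u) [VAlgebra C] :
    IsVConditional (VAlgebra.cf : C → C → C) :=
  ⟨VAlgebra.cf_self, VAlgebra.cf_le, VAlgebra.cf_sup, VAlgebra.cf_inf⟩

/-- Order isomorphisms preserve all Boolean terms. This carries the conditional of a `V`-algebra to
the clopens of its Stone space. -/
theorem IsVConditional.map {C D : Type u} [BooleanAlgebra C] [BooleanAlgebra D] {cf : C → C → C}
    (h : IsVConditional cf) (e : C ≃o D) :
    IsVConditional fun x y => e (cf (e.symm x) (e.symm y)) where
  cf_self x := by rw [h.cf_self, map_top]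
  cf_le x y z := by
    rw [← map_bihimp e, ← map_inf]
    exact e.monotone (h.cf_le _ _ _)
  cf_sup x y z := by
    rw [← map_inf, ← map_bihimp e, ← map_sup, ← map_sup, map_sup e.symm, h.cf_sup, map_top]
  cf_inf x y z := by rw [map_inf e.symm, h.cf_inf, map_inf]

/-- The selection function of a conditional on the clopen algebra of a space. -/
def conditionalSelection {S : Type u} [TopologicalSpace S]
    (cf : Clopens S → Clopens S → Clopens S) (A : Clopens S) (x : S) : Set S :=
  {y | ∀ B, x ∈ cf A B → y ∈ B}

section Selection

variable {S : Type u} [TopologicalSpace S] {cf : Clopens S → Clopens S → Clopens S}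

theorem isClosed_conditionalSelection (A : Clopens S) (x : S) :
    IsClosed (conditionalSelection cf A x) := by
  have : conditionalSelection cf A x = ⋂ (B : Clopens S) (_ : x ∈ cf A B), (B : Set S) := by
    ext y
    simp [conditionalSelection]
  rw [this]
  exact isClosed_iInter fun B => isClosed_iInter fun _ => B.isClopen.isClosed

theorem IsVConditional.mono {C : Type u} [BooleanAlgebra C] {cf : C → C → C}
    (h : IsVConditional cf) (x : C) {y z : C} (hyz : y ≤ z) : cf x y ≤ cf x z := by
  rw [← inf_eq_left.2 hyz, h.cf_inf]
  exact inf_le_right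

/-- By laws (1) and (4) the `D` with `x ∈ cf A D` form a nonempty family closed under meets. If
their intersection lies in `B`, compactness gives one such `D ≤ B`, and `cf A` is monotone. -/
theorem IsVConditional.selection_subset_iff [CompactSpace S] (h : IsVConditional cf)
    (A B : Clopens S) (x : S) : conditionalSelection cf A x ⊆ B ↔ x ∈ cf A B := by
  refine ⟨fun hsub => ?_, fun hx y hy => hy B hx⟩
  obtain ⟨D, hD, hle⟩ := exists_subset_of_iInter_clopens_subset {D | x ∈ cf A D}
    ⟨A, by
      rw [Set.mem_ofPred_eq, h.cf_self]
      trivial⟩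
    (fun D hD E hE => by
      rw [Set.mem_ofPred_eq, h.cf_inf]
      exact ⟨hD, hE⟩) B (fun y hy => hsub hy)
  exact h.mono A hle hD

variable [CompactSpace S] [T2Space S] [TotallyDisconnectedSpace S]

/-- The topological alpha-model of a conditional on the clopen algebra of a Stone space. -/
def IsVConditional.alphaModel (h : IsVConditional cf) : AlphaModel.{u} where
  carrier := S
  f := conditionalSelection cf
  subset_self A x := by
    rw [h.selection_subset_iff, h.cf_self]
    trivial
  eq_of_subset A B x hAB hBA := by
    rw [h.selection_subset_iff] at hAB hBA
    refine eq_of_forall_clopens_subset_iff (isClosed_conditionalSelection A x)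
      (isClosed_conditionalSelection B x) fun D => ?_
    rw [h.selection_subset_iff, h.selection_subset_iff, ← mem_bihimp_clopens]
    exact h.cf_le A B D ⟨hAB, hBA⟩
  sup_cases A B x := by
    rw [or_iff_not_imp_left, or_iff_not_imp_left]
    intro hA hB
    rw [h.selection_subset_iff] at hA hB
    refine eq_of_forall_clopens_subset_iff (isClosed_conditionalSelection _ x)
      ((isClosed_conditionalSelection A x).union (isClosed_conditionalSelection B x)) fun D => ?_
    rw [Set.union_subset_iff, h.selection_subset_iff, h.selection_subset_iff,
      h.selection_subset_iff]
    have hx : x ∈ cf (A ⊔ B) A ⊔ cf (A ⊔ B) B ⊔ bihimp (cf (A ⊔ B) D) (cf A D ⊓ cf B D) := by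
      rw [h.cf_sup]
      trivial
    exact (mem_bihimp_clopens _ _ x).1 (hx.resolve_left fun h' => h'.elim hA hB)
  isClopen_cf A B := by
    simp only [h.selection_subset_iff]
    exact (cf A B).isClopen
  isClosed_f := isClosed_conditionalSelection

end Selection

/-! ### The sphere system of a selection function -/

namespace AlphaModel

variable (M : AlphaModel.{u}) {A B D : Clopens M.carrier} {x : M.carrier}

/-- Apply the three-case axiom to `B = A ⊔ (B \ A)`; meeting `A` rules out the case `f B x ⊆ B \ A`.
-/
theorem f_inter_eq (hAB : A ≤ B) (hne : (M.f B x ∩ A).Nonempty) : M.f B x ∩ A = M.f A x := by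
  have hB : A ⊔ (B \ A) = B := sup_sdiff_cancel_right hAB
  obtain ⟨z, hz, hzA⟩ := hne
  have hcases := M.sup_cases A (B \ A) x
  rw [hB] at hcases
  rcases hcases with h | h | h
  · rw [Set.inter_eq_left.2 h]
    exact M.eq_of_subset B A x h ((M.subset_self A x).trans hAB)
  · exact ((h hz).2 hzA).elim
  · rw [h, Set.union_inter_distrib_right, Set.inter_eq_left.2 (M.subset_self A x)]
    refine Set.union_eq_left.2 ?_
    rintro y ⟨hy, hyA⟩
    exact ((M.subset_self _ x hy).2 hyA).elim

theorem f_subset_of_inter_nonempty (hAB : A ≤ B) (hne : (M.f B x ∩ A).Nonempty) :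
    M.f A x ⊆ M.f B x := by
  rw [← M.f_inter_eq hAB hne]
  exact Set.inter_subset_left

/-- If `f B x` were empty it would lie in `A`, while `f A x ⊆ A ⊆ B`, so the two values would
coincide. -/
theorem f_nonempty_mono (hAB : A ≤ B) (hne : (M.f A x).Nonempty) : (M.f B x).Nonempty := by
  by_contra h
  rw [Set.not_nonempty_iff_eq_empty] at h
  have := M.eq_of_subset A B x ((M.subset_self A x).trans hAB) (h ▸ Set.empty_subset _)
  rw [this, h] at hne
  exact Set.not_nonempty_empty hne

theorem f_nonempty_of_inter_nonempty (hne : (M.f B x ∩ A).Nonempty) : (M.f A x).Nonempty := by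
  obtain ⟨z, hz, hzA⟩ := hne
  have hmeet : (M.f B x ∩ (A ⊓ B : Clopens M.carrier)).Nonempty :=
    ⟨z, hz, hzA, M.subset_self B x hz⟩
  refine M.f_nonempty_mono (inf_le_left (b := B)) ?_
  rw [← M.f_inter_eq inf_le_right hmeet]
  exact hmeet

/-- The candidate for the smallest sphere around `x` meeting `A`. -/
def sphere (A : Clopens M.carrier) (x : M.carrier) : Set M.carrier :=
  {y | ∃ B, A ≤ B ∧ y ∈ M.f B x}

/-- The spheres around a point of a topological alpha-model. -/
def spheres (x : M.carrier) : Set (Set M.carrier) :=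
  {U | ∃ A, (M.f A x).Nonempty ∧ M.sphere A x = U}

variable {M}

theorem f_subset_sphere : M.f A x ⊆ M.sphere A x := fun _ hy => ⟨A, le_rfl, hy⟩

theorem sphere_anti (hAB : A ≤ B) : M.sphere B x ⊆ M.sphere A x :=
  fun _ ⟨D, hD, hy⟩ => ⟨D, hAB.trans hD, hy⟩

theorem sphere_inter : (A : Set M.carrier) ∩ M.sphere A x = M.f A x := by
  refine Set.Subset.antisymm ?_ fun y hy => ⟨M.subset_self A x hy, f_subset_sphere hy⟩
  rintro y ⟨hyA, B, hAB, hy⟩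
  rw [← M.f_inter_eq hAB ⟨y, hy, hyA⟩]
  exact ⟨hy, hyA⟩

/-- A witness `D ≥ A` is enlarged to `D ⊔ B`. If `f (D ⊔ B) x` missed `D`, it would lie in `B`,
hence equal `f (A ⊔ B) x`, which meets `A ≤ D`. -/
theorem sphere_subset_sphere_sup (h : (M.f (A ⊔ B) x ∩ A).Nonempty) :
    M.sphere A x ⊆ M.sphere (A ⊔ B) x := by
  rintro y ⟨D, hAD, hy⟩
  have hle : A ⊔ B ≤ D ⊔ B := sup_le_sup_right hAD B
  refine ⟨D ⊔ B, hle, M.f_subset_of_inter_nonempty le_sup_left ?_ hy⟩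
  by_contra hempty
  have hsub : M.f (D ⊔ B) x ⊆ (A ⊔ B : Clopens M.carrier) := by
    intro z hz
    rcases M.subset_self _ x hz with hzD | hzB
    · exact (hempty ⟨z, hz, hzD⟩).elim
    · exact Or.inr hzB
  have heq := M.eq_of_subset _ _ x hsub ((M.subset_self _ x).trans hle)
  rw [heq] at hempty
  exact hempty (h.mono (Set.inter_subset_inter_right _ hAD))

theorem f_sup_inter_nonempty (hA : (M.f A x).Nonempty) (B : Clopens M.carrier) :
    (M.f (A ⊔ B) x ∩ A).Nonempty ∨ (M.f (A ⊔ B) x ∩ B).Nonempty := by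
  obtain ⟨y, hy⟩ := M.f_nonempty_mono (le_sup_left (b := B)) hA
  rcases M.subset_self _ x hy with h | h
  exacts [Or.inl ⟨y, hy, h⟩, Or.inr ⟨y, hy, h⟩]

theorem sphere_subset_of_inter_nonempty (h : (M.f (A ⊔ B) x ∩ A).Nonempty) :
    M.sphere A x ⊆ M.sphere B x :=
  (sphere_subset_sphere_sup h).trans (sphere_anti le_sup_right)

theorem sphere_total (hA : (M.f A x).Nonempty) (B : Clopens M.carrier) :
    M.sphere A x ⊆ M.sphere B x ∨ M.sphere B x ⊆ M.sphere A x := by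
  refine (f_sup_inter_nonempty hA B).imp sphere_subset_of_inter_nonempty fun h => ?_
  rw [sup_comm] at h
  exact sphere_subset_of_inter_nonempty h

theorem f_nonempty_of_sphere_inter_nonempty (h : (M.sphere B x ∩ A).Nonempty) :
    (M.f A x).Nonempty := by
  obtain ⟨y, ⟨D, -, hy⟩, hyA⟩ := h
  exact M.f_nonempty_of_inter_nonempty ⟨y, hy, hyA⟩

/-- This is the minimality of the sphere of `A`. If `f (A ⊔ B) x` missed `A`, it would meet `B`, so
the sphere of `B` would lie in that of `A ⊔ B`; its point in `A` would then belong to `f (A ⊔ B) x`.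
-/
theorem sphere_subset_of_sphere_inter_nonempty (h : (M.sphere B x ∩ A).Nonempty) :
    M.sphere A x ⊆ M.sphere B x := by
  have hA := f_nonempty_of_sphere_inter_nonempty h
  by_cases hm : (M.f (A ⊔ B) x ∩ A).Nonempty
  · exact sphere_subset_of_inter_nonempty hm
  exfalso
  have hB := (f_sup_inter_nonempty hA B).resolve_left hm
  rw [sup_comm] at hB
  obtain ⟨y, hy, hyA⟩ := h
  have hy' : y ∈ M.sphere (B ⊔ A) x := sphere_subset_sphere_sup hB hy
  refine hm ⟨y, ?_, hyA⟩
  rw [sup_comm, ← sphere_inter]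
  exact ⟨Or.inr hyA, hy'⟩

theorem isLeast_sphere (hA : (M.f A x).Nonempty) :
    IsLeast {V | V ∈ M.spheres x ∧ (V ∩ (A : Set M.carrier)).Nonempty} (M.sphere A x) := by
  refine ⟨⟨⟨A, hA, rfl⟩, hA.mono fun y hy => ⟨f_subset_sphere hy, M.subset_self A x hy⟩⟩, ?_⟩
  rintro _ ⟨⟨B, -, rfl⟩, hne⟩
  exact sphere_subset_of_sphere_inter_nonempty hne

theorem f_nonempty_of_spheres_meet (h : ((A : Set M.carrier) ∩ ⋃₀ M.spheres x).Nonempty) :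
    (M.f A x).Nonempty := by
  obtain ⟨y, hyA, _, ⟨B, -, rfl⟩, hy⟩ := h
  exact f_nonempty_of_sphere_inter_nonempty ⟨y, hy, hyA⟩

theorem inter_sphereInter_spheres (A : Clopens M.carrier) (x : M.carrier) :
    (A : Set M.carrier) ∩ sphereInter M.spheres A x = M.f A x := by
  refine Set.Subset.antisymm ?_ ?_
  · rintro y ⟨hyA, hy⟩
    have hA := f_nonempty_of_spheres_meet (meets_of_mem_sphereInter hy)
    rw [← sphere_inter]
    exact ⟨hyA, hy.2 _ (isLeast_sphere hA).1.1 (isLeast_sphere hA).1.2⟩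
  · intro y hy
    have hl := isLeast_sphere ⟨y, hy⟩
    exact ⟨M.subset_self A x hy, ⟨_, hl.1⟩, fun U hU hUA => hl.2 ⟨hU, hUA⟩ (f_subset_sphere hy)⟩

variable (M)

/-- The topological sphere of a topological alpha-model. -/
def toTopSphere : TopSphere.{u} where
  carrier := M.carrier
  σ := M.spheres
  nested := by
    rintro x _ ⟨A, hA, rfl⟩ _ ⟨B, -, rfl⟩
    exact sphere_total hA B
  isClopen_cf A B := by
    simp only [inter_sphereInter_spheres]
    exact M.isClopen_cf A B
  limit x A h := ⟨_, isLeast_sphere (f_nonempty_of_spheres_meet h)⟩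
  isClosed_inter x A := by
    rw [inter_sphereInter_spheres]
    exact M.isClosed_f A x

theorem toTopSphere_toAlphaModel_f (A : Clopens M.carrier) (x : M.carrier) :
    M.toTopSphere.toAlphaModel.f A x = M.f A x :=
  inter_sphereInter_spheres A x

theorem isCentered_toTopSphere (h : ∀ x, M.f ⊤ x = {x}) : TopSphere.IsCentered M.toTopSphere := by
  intro (x : M.carrier)
  refine ⟨(⊤ : Clopens M.carrier), h x ▸ Set.singleton_nonempty x, ?_⟩
  have := sphere_inter (M := M) (A := ⊤) (x := x)
  rwa [h, Clopens.coe_top, Set.univ_inter] at this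

theorem isStalnakerian_toTopSphere (h : ∀ x, M.f ⊤ x = {x})
    (hs : ∀ A x, (M.f A x).Subsingleton) : TopSphere.IsStalnakerian M.toTopSphere := by
  refine ⟨M.isCentered_toTopSphere h, fun (A : Clopens M.carrier) (x : M.carrier) hne => ?_⟩
  obtain ⟨y, hy⟩ := f_nonempty_of_spheres_meet hne
  refine ⟨_, ⟨A, ⟨y, hy⟩, rfl⟩, y, ?_⟩
  exact sphere_inter.trans ((hs A x).eq_singleton_of_mem hy)

end AlphaModel

/-! ### Centered and Stalnakerian spheres -/

namespace TopSphere

variable {X : TopSphere.{u}}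

theorem IsCentered.mem_of_mem_sphere {x : X.carrier} (h : X.IsCentered) {U : Set X.carrier}
    (hU : U ∈ X.σ x) (hne : U.Nonempty) : x ∈ U := by
  rcases X.nested x U hU _ (h x) with hs | hs
  · obtain ⟨y, hy⟩ := hne
    rwa [← Set.mem_singleton_iff.1 (hs hy)]
  · exact hs rfl

theorem IsCentered.f_eq_singleton (h : X.IsCentered) {A : Clopens X.carrier} {x : X.carrier}
    (hx : x ∈ A) : X.toAlphaModel.f A x = {x} := by
  have hmeet : (({x} : Set X.carrier) ∩ A).Nonempty := ⟨x, rfl, hx⟩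
  refine Set.Subset.antisymm (fun y hy => hy.2.2 _ (h x) hmeet) ?_
  rintro _ rfl
  exact ⟨hx, ⟨_, h _, hmeet⟩, fun U hU hUA =>
    h.mem_of_mem_sphere hU (hUA.mono Set.inter_subset_left)⟩

theorem IsStalnakerian.f_subsingleton (h : X.IsStalnakerian) (A : Clopens X.carrier)
    (x : X.carrier) : (X.toAlphaModel.f A x).Subsingleton := by
  intro y hy z hz
  obtain ⟨U, hU, w, hw⟩ := h.2 A x (meets_of_mem_sphereInter hy.2)
  have hwA : w ∈ (A : Set X.carrier) ∩ U := hw ▸ rfl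
  -- The given `U` need not be the smallest sphere meeting `A`, but it contains the intersection of
  -- all of them.
  have hsub : X.toAlphaModel.f A x ⊆ {w} := fun v hv =>
    hw ▸ ⟨hv.1, hv.2.2 U hU ⟨w, hwA.2, hwA.1⟩⟩
  rw [Set.mem_singleton_iff.1 (hsub hy), Set.mem_singleton_iff.1 (hsub hz)]

theorem IsCentered.isLC (h : X.IsCentered) : (sphereToVAlg.obj (op X)).IsLC := by
  intro (A : Clopens X.carrier) (B : Clopens X.carrier)
  constructor
  · rintro x ⟨hA, hB⟩
    change X.toAlphaModel.f A x ⊆ (B : Set X.carrier)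
    rw [h.f_eq_singleton hA]
    exact Set.singleton_subset_iff.2 hB
  · refine le_himp_iff.2 ?_
    rintro x ⟨hx, hA⟩
    replace hx : X.toAlphaModel.f A x ⊆ (B : Set X.carrier) := hx
    rw [h.f_eq_singleton hA] at hx
    exact hx rfl

theorem IsStalnakerian.isCA (h : X.IsStalnakerian) : (sphereToVAlg.obj (op X)).IsCA := by
  refine ⟨IsCentered.isLC h.1, ?_⟩
  intro (A : Clopens X.carrier) (B : Clopens X.carrier)
  refine top_le_iff.1 ?_
  intro x _
  change X.toAlphaModel.f A x ⊆ (B : Set X.carrier) ∨ X.toAlphaModel.f A x ⊆ (B : Set X.carrier)ᶜ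
  rcases (h.f_subsingleton A x).eq_empty_or_singleton with h0 | ⟨y, h0⟩
  · exact Or.inl (h0 ▸ Set.empty_subset _)
  · rw [h0]
    exact (em (y ∈ (B : Set X.carrier))).imp Set.singleton_subset_iff.2 Set.singleton_subset_iff.2

end TopSphere

/-! ### The dual equivalence -/

/-- An order isomorphism preserving the conditional is an isomorphism of `V`-algebras. -/
def VAlg.isoOfOrderIso {C D : VAlg.{u}} (e : C.carrier ≃o D.carrier)
    (he : ∀ x y, e (VAlgebra.cf x y) = VAlgebra.cf (e x) (e y)) : C ≅ D where
  hom := ({ (e : BoundedLatticeHom C.carrier D.carrier) with map_cf' := he } :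
    VAlgebraHom C.carrier D.carrier)
  inv := ({ (e.symm : BoundedLatticeHom D.carrier C.carrier) with
    map_cf' := fun x y => by
      change e.symm _ = VAlgebra.cf (e.symm x) (e.symm y)
      rw [e.symm_apply_eq, he, e.apply_symm_apply, e.apply_symm_apply] } :
    VAlgebraHom D.carrier C.carrier)
  hom_inv_id := by
    refine VAlgebraHom.ext (funext fun x => ?_)
    exact e.symm_apply_apply x
  inv_hom_id := by
    refine VAlgebraHom.ext (funext fun x => ?_)
    exact e.apply_symm_apply x

namespace VAlg

variable (C : VAlg.{u})

/-- The conditional of a `V`-algebra, on the clopen algebra of its Stone space. -/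
noncomputable def stoneCf (A B : Clopens (StonePoint C.carrier)) :
    Clopens (StonePoint C.carrier) :=
  StonePoint.orderIso (VAlgebra.cf (StonePoint.orderIso.symm A) (StonePoint.orderIso.symm B))

theorem isVConditional_stoneCf : IsVConditional C.stoneCf :=
  (VAlgebra.isVConditional C.carrier).map StonePoint.orderIso

/-- The topological alpha-model dual to a `V`-algebra. -/
noncomputable def dualAlphaModel : AlphaModel.{u} :=
  C.isVConditional_stoneCf.alphaModel

/-- The topological sphere dual to a `V`-algebra. -/
noncomputable def dualSphere : TopSphere.{u} :=
  C.dualAlphaModel.toTopSphere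

theorem dualAlphaModel_f_subset_iff (A B : Clopens (StonePoint C.carrier))
    (x : StonePoint C.carrier) : C.dualAlphaModel.f A x ⊆ (B : Set (StonePoint C.carrier)) ↔ x ∈ C.stoneCf A B :=
  C.isVConditional_stoneCf.selection_subset_iff A B x

/-- A `V`-algebra is isomorphic to the clopen algebra of its dual sphere. -/
noncomputable def dualIso : C ≅ sphereToVAlg.obj (op C.dualSphere) :=
  isoOfOrderIso (D := sphereToVAlg.obj (op C.dualSphere))
    (StonePoint.orderIso : C.carrier ≃o Clopens (StonePoint C.carrier)) fun a b => by
      refine Clopens.ext (Set.ext fun (x : StonePoint C.carrier) => ?_)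
      have hf := AlphaModel.toTopSphere_toAlphaModel_f C.dualAlphaModel (StonePoint.orderIso a) x
      have hiff := C.dualAlphaModel_f_subset_iff (StonePoint.orderIso a) (StonePoint.orderIso b) x
      rw [← hf, stoneCf, OrderIso.symm_apply_apply, OrderIso.symm_apply_apply] at hiff
      exact hiff.symm

variable {C}

theorem IsLC.dualAlphaModel_f_top (h : C.IsLC) (x : StonePoint C.carrier) :
    C.dualAlphaModel.f ⊤ x = {x} := by
  -- For antecedent `⊤`, both LC bounds reduce to the consequent.
  have hcf : ∀ B, C.stoneCf ⊤ B = B := fun B => by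
    have h' := h ⊤ (StonePoint.orderIso.symm B)
    rw [top_inf_eq, top_himp] at h'
    rw [stoneCf, map_top, ← le_antisymm h'.1 h'.2, OrderIso.apply_symm_apply]
  refine eq_of_forall_clopens_subset_iff (S := StonePoint C.carrier)
    (C.dualAlphaModel.isClosed_f ⊤ x) isClosed_singleton fun B => ?_
  refine (C.dualAlphaModel_f_subset_iff ⊤ B x).trans ?_
  rw [hcf]
  exact Set.singleton_subset_iff.symm

/-- Conditional excluded middle puts `f A x` inside `B` or inside `Bᶜ` for every clopen `B`, so
clopens cannot separate two of its points. -/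
theorem IsCA.dualAlphaModel_f_subsingleton (h : C.IsCA) (A : Clopens (StonePoint C.carrier))
    (x : StonePoint C.carrier) : (C.dualAlphaModel.f A x).Subsingleton := by
  intro y hy z hz
  refine eq_of_forall_mem_clopens (S := StonePoint C.carrier) fun B hzB => ?_
  have hx : x ∈ C.stoneCf A B ⊔ C.stoneCf A Bᶜ := by
    rw [stoneCf, stoneCf, map_compl', ← map_sup, h.2, map_top]
    trivial
  rcases hx with hx | hx
  · exact (C.dualAlphaModel_f_subset_iff A B x).2 hx hy
  · exact ((C.dualAlphaModel_f_subset_iff A Bᶜ x).2 hx hz hzB).elim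

theorem IsLC.isCentered_dualSphere (h : C.IsLC) : C.dualSphere.IsCentered :=
  C.dualAlphaModel.isCentered_toTopSphere h.dualAlphaModel_f_top

theorem IsCA.isStalnakerian_dualSphere (h : C.IsCA) : C.dualSphere.IsStalnakerian :=
  C.dualAlphaModel.isStalnakerian_toTopSphere (IsLC.dualAlphaModel_f_top h.1)
    h.dualAlphaModel_f_subsingleton

end VAlg

instance sphereToVAlg_faithful : sphereToVAlg.{u}.Faithful where
  map_injective {X Y} φ ψ h := by
    refine Quiver.Hom.unop_inj (SphereHom.ext (funext fun x => ?_))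
    refine eq_of_forall_mem_clopens fun A hA => ?_
    have hA' := congrArg (fun g : VAlgebraHom (sphereToVAlg.obj X).carrier
      (sphereToVAlg.obj Y).carrier => g.toFun A) h
    exact (SetLike.ext_iff.1 (show (_ : Clopens Y.unop.carrier) = _ from hA') x).2 hA

/-- The two conditions on an alpha-morphism amount to an equality with an image. -/
theorem AlphaModel.image_f_eq {M N : AlphaModel.{u}} {φ : M.carrier → N.carrier}
    (hφ : Continuous φ)
    (h : ∀ (A B : Clopens N.carrier) (x : M.carrier),
      M.f (clopenPreimage φ hφ A) x ⊆ clopenPreimage φ hφ B ↔ N.f A (φ x) ⊆ B)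
    (A : Clopens N.carrier) (x : M.carrier) :
    φ '' M.f (clopenPreimage φ hφ A) x = N.f A (φ x) :=
  eq_of_forall_clopens_subset_iff ((M.isClosed_f _ x).isCompact.image hφ).isClosed
    (N.isClosed_f A _) fun B => Set.image_subset_iff.trans (h A B x)

theorem exists_alphaHom_clopenPreimage_eq (M N : AlphaModel.{u})
    (g : @VAlgebraHom (Clopens N.carrier) (Clopens M.carrier) N.vAlgebra M.vAlgebra) :
    ∃ ψ : AlphaHom M N, ∀ A, clopenPreimage ψ.toFun ψ.continuous A = g.toFun A := by
  let := N.vAlgebra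
  let := M.vAlgebra
  obtain ⟨φ, hφ, hg⟩ := exists_continuous_clopenPreimage_eq g.toBoundedLatticeHom
  have him := AlphaModel.image_f_eq hφ fun A B x => by
    have hcf := g.map_cf' A B
    have e : ∀ D, g.toFun D = clopenPreimage φ hφ D := fun D => (hg D).symm
    rw [e, e, e] at hcf
    exact (SetLike.ext_iff.1 hcf x).symm
  exact ⟨{ toFun := φ
           continuous := hφ
           forth := fun A x y hy => (him A x).subset ⟨y, hy, rfl⟩
           back := fun A x y' hy' => by
             obtain ⟨y, hy, rfl⟩ := (him A x).symm.subset hy'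
             exact ⟨y, rfl, hy⟩ }, hg⟩

/-- An alpha-morphism between the alpha-models of spheres is a sphere morphism. -/
def AlphaHom.toSphereHom {X Y : TopSphere.{u}} (ψ : AlphaHom X.toAlphaModel Y.toAlphaModel) :
    SphereHom X Y where
  toFun := ψ.toFun
  continuous := ψ.continuous
  forth A x y _ hy := (ψ.forth A x y hy).2
  back A x y' _ hy' := by
    obtain ⟨y, hyy, hy⟩ := ψ.back A x y' hy'
    exact ⟨y, hyy, hy.2⟩

instance sphereToVAlg_full : sphereToVAlg.{u}.Full where
  map_surjective {X Y} g := by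
    obtain ⟨ψ, hψ⟩ := exists_alphaHom_clopenPreimage_eq Y.unop.toAlphaModel X.unop.toAlphaModel g
    exact ⟨Quiver.Hom.op (X := Y.unop) (Y := X.unop) ψ.toSphereHom, VAlgebraHom.ext (funext hψ)⟩

instance sphereToVAlg_essSurj : sphereToVAlg.{u}.EssSurj where
  mem_essImage C := ⟨op C.dualSphere, ⟨C.dualIso.symm⟩⟩

/-- A fully faithful contravariant functor restricts to a dual equivalence between full
subcategories as soon as it maps the first into the second and every object of the second is
isomorphic to the image of an object of the first. -/
theorem isEquivalence_lift_op {𝒞 𝒟 : Type*} [Category 𝒞] [Category 𝒟] (F : 𝒞ᵒᵖ ⥤ 𝒟) [F.Full]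
    [F.Faithful] (P : ObjectProperty 𝒞) (Q : ObjectProperty 𝒟)
    (h : ∀ X : P.FullSubcategoryᵒᵖ, Q ((P.ι.op ⋙ F).obj X))
    (hsurj : ∀ D, Q D → ∃ X, P X ∧ Nonempty (F.obj (op X) ≅ D)) :
    (Q.lift (P.ι.op ⋙ F) h).IsEquivalence :=
  { essSurj := ⟨fun D => by
      obtain ⟨X, hX, ⟨i⟩⟩ := hsurj D.obj D.property
      exact ⟨op ⟨X, hX⟩, ⟨Q.isoMk i⟩⟩⟩ }

theorem mainTheorem4 :
    (sphereToVAlg.{u}).IsEquivalence ∧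
    (∃ h : ∀ X : (TopSphere.IsCentered.{u}.FullSubcategory)ᵒᵖ,
        VAlg.IsLC.{u} ((TopSphere.IsCentered.{u}.ι.op ⋙ sphereToVAlg.{u}).obj X),
      (VAlg.IsLC.{u}.lift (TopSphere.IsCentered.{u}.ι.op ⋙ sphereToVAlg.{u}) h).IsEquivalence) ∧
    (∃ h : ∀ X : (TopSphere.IsStalnakerian.{u}.FullSubcategory)ᵒᵖ,
        VAlg.IsCA.{u} ((TopSphere.IsStalnakerian.{u}.ι.op ⋙ sphereToVAlg.{u}).obj X),
      (VAlg.IsCA.{u}.lift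
        (TopSphere.IsStalnakerian.{u}.ι.op ⋙ sphereToVAlg.{u}) h).IsEquivalence) := by
  -- The first component is assembled from the full, faithful and essentially surjective instances.
  refine ⟨{}, ⟨fun X => TopSphere.IsCentered.isLC X.unop.property, ?_⟩,
    ⟨fun X => TopSphere.IsStalnakerian.isCA X.unop.property, ?_⟩⟩
  · exact isEquivalence_lift_op _ _ _ _ fun C hC =>
      ⟨C.dualSphere, VAlg.IsLC.isCentered_dualSphere hC, ⟨C.dualIso.symm⟩⟩
  · exact isEquivalence_lift_op _ _ _ _ fun C hC =>
      ⟨C.dualSphere, VAlg.IsCA.isStalnakerian_dualSphere hC, ⟨C.dualIso.symm⟩⟩
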